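/- For positive integers $s_1,\dots,s_r$ and signs $\varepsilon_1,\dots,\varepsilon_r\in\{1,-1\}$ put $$\zeta(s_1,\dots,s_r;\varepsilon_1,\dots,\varepsilon_r)=\sum_{k_1>\cdots>k_r\ge 1}\frac{\varepsilon_1^{k_1}\cdots\varepsilon_r^{k_r}}{k_1^{s_1}\cdots k_r^{s_r}},\qquad \zeta^\star(s_1,\dots,s_r;\varepsilon_1,\dots,\varepsilon_r)=\sum_{k_1\ge\cdots\ge k_r\ge 1}\frac{\varepsilon_1^{k_1}\cdots\varepsilon_r^{k_r}}{k_1^{s_1}\cdots k_r^{s_r}}$$ whenever the series converges absolutely; both are $1$ for the empty index ($r=0$). An argument $s_j$ with $\varepsilon_j=1$ is written $s_j$, one with $\varepsilon_j=-1$ is written $\overline{s}_j$ (and the list of signs is then omitted), and $\{a_1,\dots,a_l\}^d$ denotes $d$ successive repetitions of the sequence $a_1,\dots,a_l$. Then all the series below converge absolutely, and for every integer $d\ge 0$, $$\zeta^\star(\{3,1\}^d)=\sum_{k=0}^{2d}\zeta(\{\overline{2}\}^k)\,\zeta^\star(\{\overline{2}\}^{2d-k}),$$ $$\zeta^\star(\{3,1\}^d,2)=-\sum_{k=0}^{2d+1}\zeta(\{\overline{2}\}^k)\,\zeta^\star(\{\overline{2}\}^{2d+1-k}).$$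 -/

import Mathlib

namespace EulerSum

/-- A multi-index `(s₁, …, s_r)` together with signs `(ε₁, …, ε_r)`, `ε_j ∈ {1, -1}`,
as the list of the pairs `(s_j, ε_j)`. -/
abbrev SignedIndex : Type := List (ℕ × ℤˣ)

/-- The unsigned argument `s`, that is, `s` with sign `1`. -/
def plain (s : ℕ) : ℕ × ℤˣ := (s, 1)

/-- The argument `s̄`, that is, `s` with sign `-1`. -/
def bar (s : ℕ) : ℕ × ℤˣ := (s, -1)

/-- `{a₁, …, a_l}^d`: the block `b = (a₁, …, a_l)` repeated `d` times. -/
def rep (b : SignedIndex) (d : ℕ) : SignedIndex := (List.replicate d b).flatten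

/-- The summand `ε₁^{k₁} ⋯ ε_r^{k_r} / (k₁^{s₁} ⋯ k_r^{s_r})`. -/
noncomputable def term (s : SignedIndex) (k : Fin s.length → ℕ+) : ℝ :=
  ∏ j : Fin s.length, (((s.get j).2 : ℤ) : ℝ) ^ (k j : ℕ) / ((k j : ℕ) : ℝ) ^ (s.get j).1

/-- The series over `k₁ > ⋯ > k_r ≥ 1` converges (unconditionally). -/
def ZetaSummable (s : SignedIndex) : Prop :=
  Summable fun k : {k : Fin s.length → ℕ+ // StrictAnti k} => term s k.1

/-- The series over `k₁ ≥ ⋯ ≥ k_r ≥ 1` converges (unconditionally). -/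
def ZetaStarSummable (s : SignedIndex) : Prop :=
  Summable fun k : {k : Fin s.length → ℕ+ // Antitone k} => term s k.1

/-- The (alternating) multiple zeta value: the sum over `k₁ > ⋯ > k_r ≥ 1`. It is `1` for the
empty index. -/
noncomputable def zeta (s : SignedIndex) : ℝ :=
  ∑' k : {k : Fin s.length → ℕ+ // StrictAnti k}, term s k.1

/-- The (alternating) multiple zeta star value: the sum over `k₁ ≥ ⋯ ≥ k_r ≥ 1`. It is `1` for the
empty index. -/
noncomputable def zetaStar (s : SignedIndex) : ℝ :=
  ∑' k : {k : Fin s.length → ℕ+ // Antitone k}, term s k.1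

end EulerSum

namespace EulerSum

/-! Put `t_j = (-1)^j z / j²` and let `p_m(k)` be the coefficient of `z^m` in `∏_{j ≤ k} (1 + t_j) /
(1 - t_j)`. The numerator generates truncated strict sums of `{2̄}^i`, the denominator truncated
star sums, so `p_m(k)` tends to the convolution on the right-hand side. The bridge is an exact
identity for each `n` (`chainSum_threeOne`): up to the sign `(-1)^m`, the star sum of `threeOne m`
truncated at `n` equals `p_m(0) + ∑ kernel n k * (p_m(k) - p_m(k-1))`. As `n → ∞` the kernel tends
to `1` and dominated convergence (`tendsto_kernelSum`) turns this into `lim p_m`. The identity is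
proved by differencing in `n`. Two applications of the recursion `k² (p_{m+1}(k) - p_{m+1}(k-1)) =
(-1)^k (p_m(k) + p_m(k-1))`, with the summations by parts `kernel_sum_add` and `kernel_sum_sub`,
lower `m` by two and cancel the alternating signs; they produce exactly one block `3, 1`. -/

/-! ### Truncated sums over chains, strict and non-strict at once -/

/-- The index tuples with `k j ≤ b (k i)` for `i < j`: for `b = id` the antitone ones, for
`b = (· - 1)` the strictly antitone ones. -/
def IsChain (b : ℕ → ℕ) {r : ℕ} (k : Fin r → ℕ+) : Prop :=
  ∀ i j, i < j → (k j : ℕ) ≤ b (k i)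

theorem antitone_iff_isChain {r : ℕ} (k : Fin r → ℕ+) : Antitone k ↔ IsChain id k := by
  rw [antitone_iff_forall_lt]
  rfl

theorem strictAnti_iff_isChain {r : ℕ} (k : Fin r → ℕ+) :
    StrictAnti k ↔ IsChain (fun n => n - 1) k := by
  have h : ∀ a b : ℕ+, a < b ↔ (a : ℕ) ≤ (b : ℕ) - 1 := fun a b => by
    have := b.pos
    rw [← PNat.coe_lt_coe]
    omega
  simp only [StrictAnti, IsChain, h]

theorem isChain_cons {b : ℕ → ℕ} {r : ℕ} (a : ℕ+) (k : Fin r → ℕ+) :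
    IsChain b (Fin.cons a k : Fin (r + 1) → ℕ+) ↔ (∀ i, (k i : ℕ) ≤ b a) ∧ IsChain b k := by
  constructor
  · intro h
    refine ⟨fun i => by simpa using h 0 i.succ (Fin.succ_pos i), fun i j hij => ?_⟩
    simpa using h i.succ j.succ (Fin.succ_lt_succ_iff.2 hij)
  · rintro ⟨h₁, h₂⟩ i j hij
    induction i using Fin.cases with
    | zero =>
      induction j using Fin.cases with
      | zero => exact absurd hij (lt_irrefl _)
      | succ j => simpa using h₁ j
    | succ i =>
      induction j using Fin.cases with
      | zero => exact absurd hij (Fin.not_lt_zero _)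
      | succ j => simpa using h₂ i j (Fin.succ_lt_succ_iff.1 hij)

open Classical in
/-- The chains all of whose entries are at most `n`. -/
noncomputable def chainBox (b : ℕ → ℕ) (r n : ℕ) : Finset (Fin r → ℕ+) :=
  (Fintype.piFinset fun _ => (Finset.range n).map ⟨Nat.succPNat, Nat.succPNat_injective⟩).filter
    (IsChain b)

theorem mem_chainBox {b : ℕ → ℕ} {r n : ℕ} {k : Fin r → ℕ+} :
    k ∈ chainBox b r n ↔ (∀ i, (k i : ℕ) ≤ n) ∧ IsChain b k := by
  have h : ∀ a : ℕ+, (∃ m < n, Nat.succPNat m = a) ↔ (a : ℕ) ≤ n := fun a => by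
    constructor
    · rintro ⟨m, hm, rfl⟩
      exact hm
    · intro ha
      exact ⟨a.natPred, by have := a.natPred_add_one; omega, a.succPNat_natPred⟩
  simp [chainBox, Fintype.mem_piFinset, h]

/-- The sum of `w s₁ k₁ ⋯ w s_r k_r` over the chains with entries at most `n`, computed
recursively. -/
noncomputable def chainSum (w : ℕ × ℤˣ → ℕ → ℝ) (b : ℕ → ℕ) : SignedIndex → ℕ → ℝ
  | [], _ => 1
  | p :: l, n => ∑ j ∈ Finset.range n, w p (j + 1) * chainSum w b l (b (j + 1))

theorem chainSum_cons_succ (w : ℕ × ℤˣ → ℕ → ℝ) (b : ℕ → ℕ) (p : ℕ × ℤˣ) (l : SignedIndex)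
    (n : ℕ) : chainSum w b (p :: l) (n + 1) =
      chainSum w b (p :: l) n + w p (n + 1) * chainSum w b l (b (n + 1)) := by
  rw [chainSum, chainSum, Finset.sum_range_succ]

theorem sum_chainBox (w : ℕ × ℤˣ → ℕ → ℝ) {b : ℕ → ℕ} (hb : ∀ n, b n ≤ n) (l : SignedIndex)
    (n : ℕ) :
    ∑ k ∈ chainBox b l.length n, ∏ j, w (l.get j) (k j) = chainSum w b l n := by
  induction l generalizing n with
  | nil =>
    have : chainBox b ([] : SignedIndex).length n = {Fin.elim0} := by
      ext k
      rw [mem_chainBox, Finset.mem_singleton]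
      exact ⟨fun _ => funext fun i => i.elim0, fun _ => ⟨fun i => i.elim0, fun i => i.elim0⟩⟩
    rw [this, Finset.sum_singleton]
    rfl
  | cons p l ih =>
    simp only [chainSum, ← ih, Finset.mul_sum]
    rw [Finset.sum_sigma']
    refine Finset.sum_bij' (fun k _ => ⟨(k 0).natPred, Fin.tail k⟩)
      (fun x _ => (Fin.cons (Nat.succPNat x.1) x.2 : Fin (l.length + 1) → ℕ+)) ?_ ?_ ?_ ?_ ?_
    · intro k hk
      rw [mem_chainBox, ← Fin.cons_self_tail k, isChain_cons] at hk
      have h0 := hk.1 0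
      have h1 := (k 0).natPred_add_one
      rw [Fin.cons_zero] at h0
      rw [Finset.mem_sigma, Finset.mem_range, mem_chainBox, h1]
      exact ⟨by simp only; omega, hk.2⟩
    · rintro ⟨j, k⟩ hx
      rw [Finset.mem_sigma, Finset.mem_range, mem_chainBox] at hx
      rw [mem_chainBox]
      obtain ⟨hj, hk, hc⟩ := hx
      refine ⟨fun i => ?_, (isChain_cons _ _).2 ⟨hk, hc⟩⟩
      induction i using Fin.cases with
      | zero => exact hj
      | succ i =>
        have h1 := hk i
        have h2 := hb (j + 1)
        simp only [Fin.cons_succ] at h1 hj ⊢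
        omega
    · intro k _
      simp only [PNat.succPNat_natPred]
      exact Fin.cons_self_tail k
    · rintro ⟨j, k⟩ _
      simp
    · intro k _
      rw [PNat.natPred_add_one]
      exact Fin.prod_univ_succ _

theorem tendsto_chainBox {b : ℕ → ℕ} {r : ℕ} {Q : (Fin r → ℕ+) → Prop} [DecidablePred Q]
    (hQ : ∀ k, Q k ↔ IsChain b k) :
    Filter.Tendsto (fun n => (chainBox b r n).subtype Q) Filter.atTop Filter.atTop := by
  refine Filter.tendsto_atTop_finset_of_monotone (fun m n hmn k hk => ?_) (fun k => ?_)
  · rw [Finset.mem_subtype, mem_chainBox] at hk ⊢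
    exact ⟨fun i => (hk.1 i).trans hmn, hk.2⟩
  -- The sum of the entries bounds each of them, also when `r = 0`.
  · refine ⟨∑ i, (k.1 i : ℕ), ?_⟩
    rw [Finset.mem_subtype, mem_chainBox]
    exact ⟨fun i => Finset.single_le_sum (f := fun i => (k.1 i : ℕ)) (fun _ _ => Nat.zero_le _)
      (Finset.mem_univ i), (hQ _).1 k.2⟩

open Classical in
theorem sum_chainBox_subtype (w : ℕ × ℤˣ → ℕ → ℝ) {b : ℕ → ℕ} (hb : ∀ n, b n ≤ n)
    (l : SignedIndex) {Q : (Fin l.length → ℕ+) → Prop} (hQ : ∀ k, Q k ↔ IsChain b k) (n : ℕ) :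
    ∑ k ∈ (chainBox b l.length n).subtype Q, ∏ j, w (l.get j) (k.1 j) = chainSum w b l n := by
  rw [← sum_chainBox w hb]
  exact Finset.sum_subtype_of_mem (fun k : Fin l.length → ℕ+ => ∏ j, w (l.get j) (k j))
    fun k hk => (hQ k).2 (mem_chainBox.1 hk).2

/-- Every finite set of chains lies in some box, so a uniform bound on the truncated absolute sums
bounds all finite subsums. -/
theorem summable_of_chainSum_le (w : ℕ × ℤˣ → ℕ → ℝ) {b : ℕ → ℕ} (hb : ∀ n, b n ≤ n)
    (l : SignedIndex) {Q : (Fin l.length → ℕ+) → Prop} (hQ : ∀ k, Q k ↔ IsChain b k) {C : ℝ}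
    (hC : ∀ n, chainSum (fun p n => |w p n|) b l n ≤ C) :
    Summable fun k : {k // Q k} => ∏ j, w (l.get j) (k.1 j) := by
  classical
  refine Summable.of_abs (summable_of_sum_le (c := C) (fun _ => abs_nonneg _) fun u => ?_)
  obtain ⟨n, hn⟩ := ((tendsto_chainBox hQ).eventually_ge_atTop u).exists
  refine (Finset.sum_le_sum_of_subset_of_nonneg hn fun _ _ _ => abs_nonneg _).trans ?_
  simp only [Finset.abs_prod]
  exact (sum_chainBox_subtype (fun p n => |w p n|) hb l hQ n).trans_le (hC n)

theorem tendsto_chainSum (w : ℕ × ℤˣ → ℕ → ℝ) {b : ℕ → ℕ} (hb : ∀ n, b n ≤ n)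
    (l : SignedIndex) {Q : (Fin l.length → ℕ+) → Prop} (hQ : ∀ k, Q k ↔ IsChain b k)
    (hs : Summable fun k : {k // Q k} => ∏ j, w (l.get j) (k.1 j)) :
    Filter.Tendsto (chainSum w b l) Filter.atTop
      (nhds (∑' k : {k // Q k}, ∏ j, w (l.get j) (k.1 j))) := by
  classical
  have := Filter.Tendsto.comp hs.hasSum (tendsto_chainBox hQ)
  exact this.congr fun n => sum_chainBox_subtype w hb l hQ n

/-! ### Bounds for absolute convergence -/

/-- The factor `ε ^ n / n ^ s` of a summand. -/
noncomputable def weight (p : ℕ × ℤˣ) (n : ℕ) : ℝ := ((p.2 : ℤ) : ℝ) ^ n / (n : ℝ) ^ p.1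

theorem abs_weight (p : ℕ × ℤˣ) (n : ℕ) : |weight p n| = 1 / (n : ℝ) ^ p.1 := by
  have h : |((p.2 : ℤ) : ℝ)| = 1 := by
    rcases Int.units_eq_one_or p.2 with h | h <;> simp [h]
  rw [weight, abs_div, abs_pow, h, one_pow, abs_of_nonneg (by positivity)]

theorem summable_one_div_sq : Summable fun j : ℕ => 1 / ((j + 1 : ℕ) : ℝ) ^ 2 :=
  (summable_nat_add_iff 1).2 (Real.summable_one_div_nat_pow.2 one_lt_two)

theorem sum_one_div_sq_mul_le {C : ℝ} (hC : 0 ≤ C) (n : ℕ) :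
    ∑ j ∈ Finset.range n, 1 / ((j + 1 : ℕ) : ℝ) ^ 2 * C ≤
      (∑' j : ℕ, 1 / ((j + 1 : ℕ) : ℝ) ^ 2) * C := by
  rw [← Finset.sum_mul]
  exact mul_le_mul_of_nonneg_right
    (summable_one_div_sq.sum_le_tsum _ fun _ _ => by positivity) hC

theorem chainSum_abs_nonneg (b : ℕ → ℕ) (l : SignedIndex) (n : ℕ) :
    0 ≤ chainSum (fun p n => |weight p n|) b l n := by
  induction l generalizing n with
  | nil => exact zero_le_one
  | cons p l ih => exact Finset.sum_nonneg fun j _ => mul_nonneg (abs_nonneg _) (ih _)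

theorem chainSum_abs_replicate_bar_two_le (b : ℕ → ℕ) (i : ℕ) :
    ∃ C, ∀ n, chainSum (fun p n => |weight p n|) b (List.replicate i (bar 2)) n ≤ C := by
  induction i with
  | zero => exact ⟨1, fun _ => le_rfl⟩
  | succ i ih =>
    obtain ⟨C, hC⟩ := ih
    have hC0 : 0 ≤ C := (chainSum_abs_nonneg b _ 0).trans (hC 0)
    refine ⟨_, fun n => le_trans (Finset.sum_le_sum fun j _ => ?_) (sum_one_div_sq_mul_le hC0 n)⟩
    beta_reduce
    rw [abs_weight]
    exact mul_le_mul_of_nonneg_left (hC _) (by positivity)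

/-- The index `({3, 1}^d)` for `m = 2 d` and `({3, 1}^d, 2)` for `m = 2 d + 1`. -/
def threeOne : ℕ → SignedIndex
  | 0 => []
  | 1 => [plain 2]
  | m + 2 => plain 3 :: plain 1 :: threeOne m

/-- The inner sum for the argument `1` may diverge, but grows at most linearly; the outer weight `1
/ n³` absorbs this and leaves the summable `1 / n²`. -/
theorem chainSum_abs_threeOne_le (m : ℕ) :
    ∃ C, ∀ n, chainSum (fun p n => |weight p n|) id (threeOne m) n ≤ C := by
  induction m using Nat.twoStepInduction with
  | zero => exact ⟨1, fun _ => le_rfl⟩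
  | one =>
    refine ⟨_, fun n => le_trans (Finset.sum_le_sum fun j _ => ?_)
      (sum_one_div_sq_mul_le zero_le_one n)⟩
    beta_reduce
    rw [abs_weight]
    exact le_rfl
  | more m ih _ =>
    obtain ⟨C, hC⟩ := ih
    have hC0 : 0 ≤ C := (chainSum_abs_nonneg id _ 0).trans (hC 0)
    have h1 : ∀ n : ℕ, chainSum (fun p n => |weight p n|) id (plain 1 :: threeOne m) n ≤ n * C := by
      intro n
      have : ∀ j ∈ Finset.range n, |weight (plain 1) (j + 1)| *
          chainSum (fun p n => |weight p n|) id (threeOne m) (id (j + 1)) ≤ C := by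
        intro j _
        have h : |weight (plain 1) (j + 1)| ≤ 1 := by
          rw [abs_weight]
          refine div_le_one_of_le₀ (one_le_pow₀ ?_) (by positivity)
          exact_mod_cast Nat.le_add_left 1 j
        exact (mul_le_mul h (hC _) (chainSum_abs_nonneg _ _ _) zero_le_one).trans_eq (one_mul C)
      simpa [chainSum] using Finset.sum_le_card_nsmul _ _ _ this
    refine ⟨_, fun n => le_trans (Finset.sum_le_sum fun j _ => ?_) (sum_one_div_sq_mul_le hC0 n)⟩
    refine (mul_le_mul_of_nonneg_left (h1 _) (abs_nonneg _)).trans_eq ?_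
    rw [abs_weight]
    have : ((j + 1 : ℕ) : ℝ) ≠ 0 := Nat.cast_ne_zero.2 j.succ_ne_zero
    simp only [plain, id]
    field_simp

/-! ### The kernel and its summations by parts -/

/-- The quotient `n!² / ((n - k)! (n + k)!)`, which vanishes for `k > n` and tends to `1` as
`n → ∞`. -/
noncomputable def kernel (n k : ℕ) : ℝ := ∏ i ∈ Finset.range k, ((n : ℝ) - i) / (n + i + 1)

theorem kernel_zero (n : ℕ) : kernel n 0 = 1 := Finset.prod_range_zero _

theorem kernel_succ_mul (n k : ℕ) :
    kernel n (k + 1) * (n + k + 1) = kernel n k * (n - k) := by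
  have : (n : ℝ) + k + 1 ≠ 0 := by positivity
  rw [kernel, kernel, Finset.prod_range_succ]
  field_simp

theorem kernel_eq_zero {n k : ℕ} (h : n < k) : kernel n k = 0 :=
  Finset.prod_eq_zero (Finset.mem_range.2 h) (by simp)

theorem kernel_mem_Icc (n k : ℕ) : kernel n k ∈ Set.Icc (0 : ℝ) 1 := by
  rcases lt_or_ge n k with h | h
  · rw [kernel_eq_zero h]
    simp
  · have h0 : ∀ i ∈ Finset.range k, 0 ≤ ((n : ℝ) - i) / (n + i + 1) := fun i hi => by
      have : (i : ℝ) ≤ n := by exact_mod_cast ((Finset.mem_range.1 hi).trans_le h).le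
      have : 0 ≤ (n : ℝ) - i := by linarith
      positivity
    refine ⟨Finset.prod_nonneg h0, Finset.prod_le_one h0 fun i _ => ?_⟩
    rw [div_le_one (by positivity)]
    have : (0 : ℝ) ≤ i := by positivity
    linarith

theorem tendsto_kernel (k : ℕ) :
    Filter.Tendsto (fun n => kernel n k) Filter.atTop (nhds 1) := by
  have h : ∀ i ∈ Finset.range k,
      Filter.Tendsto (fun n : ℕ => ((n : ℝ) - i) / (n + i + 1)) Filter.atTop (nhds 1) := by
    intro i _
    have h1 : Filter.Tendsto (fun n : ℕ => (n : ℝ) + (i + 1)) Filter.atTop Filter.atTop :=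
      Filter.tendsto_atTop_add_const_right _ _ tendsto_natCast_atTop_atTop
    have h2 := (h1.const_div_atTop (2 * i + 1 : ℝ)).const_sub 1
    rw [sub_zero] at h2
    refine h2.congr fun n => ?_
    have : (n : ℝ) + i + 1 ≠ 0 := by positivity
    rw [← add_assoc]
    field_simp
    ring
  have := tendsto_finsetProd _ h
  rwa [Finset.prod_const_one] at this

/-- This ratio is what makes differencing in `n` insert a factor `k² / (n + 1)²`. -/
theorem kernel_pred_mul (n k : ℕ) :
    kernel n k * ((n : ℝ) + 1) ^ 2 = kernel (n + 1) k * (((n : ℝ) + 1) ^ 2 - k ^ 2) := by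
  induction k with
  | zero => simp [kernel_zero]
  | succ k ih =>
    have h1 := kernel_succ_mul n k
    have h2 := kernel_succ_mul (n + 1) k
    have h3 : (n : ℝ) + k + 1 ≠ 0 := by positivity
    have h4 : (n : ℝ) + k + 2 ≠ 0 := by positivity
    push_cast at h2 ⊢
    apply mul_right_cancel₀ h3
    linear_combination ((n : ℝ) + 1) ^ 2 * h1 + (n - k) * ih - (n - k) * (n + k + 1) * h2

/-- Summation by parts against the kernel. -/
theorem kernel_sum_sub (n : ℕ) (p : ℕ → ℝ) :
    p 0 + ∑ k ∈ Finset.range (n + 1), kernel (n + 1) (k + 1) * (p (k + 1) - p k) =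
      ∑ k ∈ Finset.range (n + 1),
        ((k : ℝ) + 1) / (n + 1) * kernel (n + 1) (k + 1) * (p (k + 1) + p k) := by
  have hn : (n : ℝ) + 1 ≠ 0 := by positivity
  -- Stopping at `N` leaves a boundary term, which vanishes at `N = n + 1`.
  have h : ∀ N : ℕ,
      p 0 + ∑ k ∈ Finset.range N, kernel (n + 1) (k + 1) * (p (k + 1) - p k) =
      ∑ k ∈ Finset.range N,
        ((k : ℝ) + 1) / (n + 1) * kernel (n + 1) (k + 1) * (p (k + 1) + p k) +
      kernel (n + 1) N * (1 - N / (n + 1)) * p N := by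
    intro N
    induction N with
    | zero => simp [kernel_zero]
    | succ N ih =>
      rw [Finset.sum_range_succ, Finset.sum_range_succ, ← add_assoc, ih]
      have h2 := kernel_succ_mul (n + 1) N
      push_cast at h2 ⊢
      field_simp
      linear_combination -p N * h2
  rw [h (n + 1)]
  push_cast
  rw [div_self hn]
  ring

/-- Alternating summation by parts against the kernel. -/
theorem kernel_sum_add (n : ℕ) (q : ℕ → ℝ) :
    ∑ k ∈ Finset.range (n + 1), (-1) ^ (k + 1) * (q (k + 1) + q k) *
        (((n : ℝ) + 1) * kernel (n + 1) (k + 1) - n * kernel n (k + 1)) =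
      (∑ k ∈ Finset.range (n + 1), (-1) ^ (k + 1) * ((k : ℝ) + 1) ^ 3 *
        kernel (n + 1) (k + 1) * (q (k + 1) - q k)) / ((n : ℝ) + 1) ^ 2 - q 0 := by
  have hn : (n : ℝ) + 1 ≠ 0 := by positivity
  -- The boundary term again vanishes at `N = n + 1`; at `N = 0` it equals `q 0`, whence the `- q
  -- 0`.
  have h : ∀ N : ℕ, ∑ k ∈ Finset.range N, (-1) ^ (k + 1) * (q (k + 1) + q k) *
        (((n : ℝ) + 1) * kernel (n + 1) (k + 1) - n * kernel n (k + 1)) =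
      (∑ k ∈ Finset.range N, (-1) ^ (k + 1) * ((k : ℝ) + 1) ^ 3 *
        kernel (n + 1) (k + 1) * (q (k + 1) - q k)) / ((n : ℝ) + 1) ^ 2 - q 0 +
      (-1) ^ N * kernel (n + 1) N * (n + 1 - N) * ((N : ℝ) ^ 2 + N + n + 1) /
        ((n : ℝ) + 1) ^ 2 * q N := by
    intro N
    induction N with
    | zero =>
      simp only [Finset.sum_range_zero, kernel_zero, pow_zero]
      push_cast
      field_simp
      ring
    | succ N ih =>
      rw [Finset.sum_range_succ, Finset.sum_range_succ, ih]
      have h2 := kernel_succ_mul (n + 1) N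
      have h3 : kernel n (N + 1) = kernel (n + 1) (N + 1) *
          (((n : ℝ) + 1) ^ 2 - (N + 1 : ℕ) ^ 2) / ((n : ℝ) + 1) ^ 2 := by
        rw [← kernel_pred_mul]
        field_simp
      rw [h3]
      push_cast at h2 ⊢
      field_simp
      rw [pow_succ]
      linear_combination -(-1) ^ N * q N * ((N : ℝ) ^ 2 + N + n + 1) * h2
  rw [h (n + 1)]
  push_cast
  ring

/-! ### Kernel sums: differences and limit -/

/-- The sum `p₀ + ∑ k ≤ n, n!² / ((n - k)! (n + k)!) (p_k - p_{k-1})`. -/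
noncomputable def kernelSum (p : ℕ → ℝ) (n : ℕ) : ℝ :=
  p 0 + ∑ k ∈ Finset.range n, kernel n (k + 1) * (p (k + 1) - p k)

theorem kernelSum_succ_sub (p : ℕ → ℝ) (n : ℕ) :
    kernelSum p (n + 1) - kernelSum p n =
      (∑ k ∈ Finset.range (n + 1), kernel (n + 1) (k + 1) *
        (((k : ℝ) + 1) ^ 2 * (p (k + 1) - p k))) / ((n : ℝ) + 1) ^ 2 := by
  have hn : (n : ℝ) + 1 ≠ 0 := by positivity
  have h : kernelSum p n =
      p 0 + ∑ k ∈ Finset.range (n + 1), kernel n (k + 1) * (p (k + 1) - p k) := by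
    rw [kernelSum, Finset.sum_range_succ, kernel_eq_zero n.lt_succ_self]
    ring
  rw [h, kernelSum, add_sub_add_left_eq_sub, ← Finset.sum_sub_distrib, Finset.sum_div]
  refine Finset.sum_congr rfl fun k _ => ?_
  have h3 := kernel_pred_mul n (k + 1)
  push_cast at h3
  field_simp
  linear_combination -(p (k + 1) - p k) * h3

/-- Dominated convergence: the kernel lies in `[0, 1]` and tends to `1` for fixed `k`, and the
limiting series telescopes. -/
theorem tendsto_kernelSum {p : ℕ → ℝ} {L : ℝ} (hp : Summable fun k => |p (k + 1) - p k|)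
    (hL : Filter.Tendsto p Filter.atTop (nhds L)) :
    Filter.Tendsto (kernelSum p) Filter.atTop (nhds L) := by
  have h1 : ∑' k, (p (k + 1) - p k) = L - p 0 := by
    have := hp.of_abs.hasSum.tendsto_sum_nat
    simp only [Finset.sum_range_sub] at this
    exact tendsto_nhds_unique this (hL.sub_const _)
  have h2 : ∀ n, kernelSum p n = p 0 + ∑' k, kernel n (k + 1) * (p (k + 1) - p k) := by
    intro n
    rw [kernelSum, tsum_eq_sum]
    intro k hk
    rw [kernel_eq_zero (by simpa [Nat.lt_succ_iff] using hk), zero_mul]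
  have h3 : Filter.Tendsto (fun n => ∑' k, kernel n (k + 1) * (p (k + 1) - p k)) Filter.atTop
      (nhds (∑' k, (p (k + 1) - p k))) := by
    refine tendsto_tsum_of_dominated_convergence hp (fun k => ?_) (Filter.Eventually.of_forall
      fun n k => ?_)
    · simpa using (tendsto_kernel (k + 1)).mul_const (p (k + 1) - p k)
    · have := kernel_mem_Icc n (k + 1)
      rw [Real.norm_eq_abs, abs_mul, abs_of_nonneg this.1]
      exact mul_le_of_le_one_left (abs_nonneg _) this.2
  have h4 := h3.const_add (p 0)
  rw [h1, add_sub_cancel] at h4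
  exact h4.congr fun n => (h2 n).symm

/-! ### The finite identity -/

/-- Finite form of the evaluation: the truncated star sums of `({3, 1}^d)` and `({3, 1}^d, 2)`
as kernel sums of a solution of the recursion satisfied by the coefficients of
`∏ (1 + t_k) / (1 - t_k)`, `t_k = (-1)^k z / k²`. -/
theorem chainSum_threeOne {p : ℕ → ℕ → ℝ} (h0 : ∀ k, p 0 k = 1) (hz : ∀ m, p (m + 1) 0 = 0)
    (hp : ∀ m k : ℕ, ((k : ℝ) + 1) ^ 2 * (p (m + 1) (k + 1) - p (m + 1) k) =
      (-1) ^ (k + 1) * (p m (k + 1) + p m k)) (m n : ℕ) :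
    (-1) ^ m * chainSum weight id (threeOne m) n = kernelSum (p m) n := by
  -- the sums `n ∑ k, kernel n k · k² (p_k - p_{k-1})` in terms of the next lower coefficient
  have hD : ∀ m n : ℕ, ((n : ℝ) + 1) * ∑ k ∈ Finset.range (n + 1), kernel (n + 1) (k + 1) *
        (((k : ℝ) + 1) ^ 2 * (p (m + 1) (k + 1) - p (m + 1) k)) -
      n * ∑ k ∈ Finset.range n, kernel n (k + 1) *
        (((k : ℝ) + 1) ^ 2 * (p (m + 1) (k + 1) - p (m + 1) k)) =
      (∑ k ∈ Finset.range (n + 1), (-1) ^ (k + 1) * ((k : ℝ) + 1) ^ 3 *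
        kernel (n + 1) (k + 1) * (p m (k + 1) - p m k)) / ((n : ℝ) + 1) ^ 2 - p m 0 := by
    intro m n
    have : ∑ k ∈ Finset.range n, kernel n (k + 1) *
        (((k : ℝ) + 1) ^ 2 * (p (m + 1) (k + 1) - p (m + 1) k)) =
      ∑ k ∈ Finset.range (n + 1), kernel n (k + 1) *
        (((k : ℝ) + 1) ^ 2 * (p (m + 1) (k + 1) - p (m + 1) k)) := by
      rw [Finset.sum_range_succ _ n, kernel_eq_zero n.lt_succ_self, zero_mul, add_zero]
    rw [this, ← kernel_sum_add, Finset.mul_sum, Finset.mul_sum, ← Finset.sum_sub_distrib]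
    refine Finset.sum_congr rfl fun k _ => ?_
    rw [hp]
    ring
  induction m using Nat.twoStepInduction generalizing n with
  | zero => simp [threeOne, chainSum, kernelSum, h0]
  | one =>
    -- Since `p 0` is constant, only `-p 0 0 = -1` survives in `hD`; this is the source of the sign
    -- for odd `m`.
    have hS : ∀ n : ℕ, (n : ℝ) * ∑ k ∈ Finset.range n, kernel n (k + 1) *
        (((k : ℝ) + 1) ^ 2 * (p 1 (k + 1) - p 1 k)) = -n := by
      intro n
      induction n with
      | zero => simp
      | succ n ih =>
        have := hD 0 n
        simp only [zero_add, h0, sub_self, mul_zero, Finset.sum_const_zero, zero_div] at this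
        push_cast
        linarith
    induction n with
    | zero => simp [threeOne, chainSum, kernelSum, hz]
    | succ n ih =>
      have hn : (n : ℝ) + 1 ≠ 0 := by positivity
      have h1 := kernelSum_succ_sub (p 1) n
      have h2 := hS (n + 1)
      push_cast at h2
      have h3 : ∑ k ∈ Finset.range (n + 1), kernel (n + 1) (k + 1) *
          (((k : ℝ) + 1) ^ 2 * (p 1 (k + 1) - p 1 k)) = -1 :=
        mul_left_cancel₀ hn (by rw [h2]; ring)
      rw [h3, sub_eq_iff_eq_add, ← ih] at h1
      rw [h1]
      simp only [threeOne, chainSum, Finset.sum_range_succ]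
      simp [weight, plain]
      ring
  | more m ih _ =>
    -- This difference in `n` supplies the argument `1`; dividing by `n` here and by `n²` in
    -- `kernelSum_succ_sub` then gives the argument `3`.
    have hS : ∀ n : ℕ, (n : ℝ) * ∑ k ∈ Finset.range n, kernel n (k + 1) *
        (((k : ℝ) + 1) ^ 2 * (p (m + 2) (k + 1) - p (m + 2) k)) =
        (-1) ^ m * chainSum weight id (plain 1 :: threeOne m) n := by
      intro n
      induction n with
      | zero => simp [chainSum]
      | succ n ihn =>
        have hn : (n : ℝ) + 1 ≠ 0 := by positivity
        have h1 := hD (m + 1) n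
        have h2 := ih (n + 1)
        rw [kernelSum, kernel_sum_sub] at h2
        have h3 : (∑ k ∈ Finset.range (n + 1), (-1) ^ (k + 1) * ((k : ℝ) + 1) ^ 3 *
            kernel (n + 1) (k + 1) * (p (m + 1) (k + 1) - p (m + 1) k)) / ((n : ℝ) + 1) ^ 2 =
            (-1) ^ m * chainSum weight id (threeOne m) (n + 1) / (n + 1) := by
          rw [h2, Finset.sum_div, Finset.sum_div]
          refine Finset.sum_congr rfl fun k _ => ?_
          -- The sign from this second use of the recursion cancels the one from the first.
          have h4 := hp m k
          have h5 : ((-1 : ℝ) ^ (k + 1)) * (-1) ^ (k + 1) = 1 := by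
            rw [← mul_pow]; norm_num
          field_simp
          linear_combination kernel (n + 1) (k + 1) *
            ((-1) ^ (k + 1) * h4 + (p m (k + 1) + p m k) * h5)
        rw [h3, ihn, hz, sub_zero, sub_eq_iff_eq_add] at h1
        push_cast
        rw [h1]
        simp only [chainSum, Finset.sum_range_succ]
        simp [weight, plain]
        ring
    induction n with
    | zero => simp [threeOne, chainSum, kernelSum, hz]
    | succ n ihn =>
      have hn : (n : ℝ) + 1 ≠ 0 := by positivity
      have h1 := kernelSum_succ_sub (p (m + 2)) n
      have h2 := hS (n + 1)
      push_cast at h2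
      rw [eq_div_of_mul_eq hn ((mul_comm _ _).trans h2), sub_eq_iff_eq_add, ← ihn] at h1
      rw [h1]
      simp only [threeOne]
      rw [chainSum_cons_succ]
      have h3 : weight (plain 3) (n + 1) = 1 / ((n : ℝ) + 1) ^ 3 := by simp [weight, plain]
      rw [h3, id, pow_add]
      field_simp
      ring

/-! ### Index bookkeeping and passage to infinite sums -/

theorem rep_singleton (a : ℕ × ℤˣ) (d : ℕ) : rep [a] d = List.replicate d a := by
  induction d with
  | zero => rfl
  | succ d ih => rw [List.replicate_succ, ← ih]; rfl

theorem rep_three_one (d : ℕ) : rep [plain 3, plain 1] d = threeOne (2 * d) := by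
  induction d with
  | zero => rfl
  | succ d ih => rw [mul_add, mul_one, threeOne, ← ih]; rfl

theorem threeOne_append_two (d : ℕ) :
    threeOne (2 * d) ++ [plain 2] = threeOne (2 * d + 1) := by
  induction d with
  | zero => rfl
  | succ d ih =>
    rw [show 2 * (d + 1) + 1 = 2 * d + 1 + 2 by ring, threeOne, ← ih]
    rfl

theorem zetaSummable_bar_two (i : ℕ) : ZetaSummable (List.replicate i (bar 2)) := by
  obtain ⟨C, hC⟩ := chainSum_abs_replicate_bar_two_le (fun n => n - 1) i
  exact summable_of_chainSum_le weight (fun n => n.sub_le 1) _ strictAnti_iff_isChain hC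

theorem zetaStarSummable_bar_two (i : ℕ) : ZetaStarSummable (List.replicate i (bar 2)) := by
  obtain ⟨C, hC⟩ := chainSum_abs_replicate_bar_two_le id i
  exact summable_of_chainSum_le weight (fun n => le_rfl) _ antitone_iff_isChain hC

theorem zetaStarSummable_threeOne (m : ℕ) : ZetaStarSummable (threeOne m) := by
  obtain ⟨C, hC⟩ := chainSum_abs_threeOne_le m
  exact summable_of_chainSum_le weight (fun n => le_rfl) _ antitone_iff_isChain hC

theorem ZetaSummable.tendsto_chainSum {s : SignedIndex} (hs : ZetaSummable s) :
    Filter.Tendsto (chainSum weight (fun n => n - 1) s) Filter.atTop (nhds (zeta s)) :=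
  EulerSum.tendsto_chainSum weight (fun n => n.sub_le 1) s strictAnti_iff_isChain hs

theorem ZetaStarSummable.tendsto_chainSum {s : SignedIndex} (hs : ZetaStarSummable s) :
    Filter.Tendsto (chainSum weight id s) Filter.atTop (nhds (zetaStar s)) :=
  EulerSum.tendsto_chainSum weight (fun _ => le_rfl) s antitone_iff_isChain hs

/-! ### Generating series and conclusion -/

/-- The generating series of the sums over chains with entries at most `k` for `({2̄}^i)`. -/
noncomputable def barTwoSeries (b : ℕ → ℕ) (k : ℕ) : PowerSeries ℝ :=
  PowerSeries.mk fun i => chainSum weight b (List.replicate i (bar 2)) k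

/-- The `m`-th coefficient of the product over `j ≤ k` of `(1 + t_j) / (1 - t_j)` with
`t_j = (-1)^j z / j²`. -/
noncomputable def barTwoCoeff (m k : ℕ) : ℝ :=
  PowerSeries.coeff m (barTwoSeries (fun n => n - 1) k * barTwoSeries id k)

theorem weight_bar_two (k : ℕ) : weight (bar 2) (k + 1) = (-1) ^ (k + 1) / ((k : ℝ) + 1) ^ 2 := by
  simp [weight, bar]

/-- A strict chain uses the value `k + 1` at most once, hence the factor `1 + t_{k+1}`. -/
theorem barTwoSeries_strict_succ (k : ℕ) :
    barTwoSeries (fun n => n - 1) (k + 1) =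
      (1 + PowerSeries.X * PowerSeries.C (weight (bar 2) (k + 1))) *
        barTwoSeries (fun n => n - 1) k := by
  rw [add_mul, one_mul, mul_assoc]
  ext i
  cases i with
  | zero => simp [barTwoSeries, chainSum]
  | succ i =>
    rw [map_add, PowerSeries.coeff_succ_X_mul, PowerSeries.coeff_C_mul]
    simp only [barTwoSeries, PowerSeries.coeff_mk, List.replicate_succ]
    rw [chainSum_cons_succ]
    rfl

/-- A weak chain may repeat `k + 1` arbitrarily often, hence the factor `1 / (1 - t_{k+1})`. -/
theorem barTwoSeries_id_succ (k : ℕ) :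
    (1 - PowerSeries.X * PowerSeries.C (weight (bar 2) (k + 1))) * barTwoSeries id (k + 1) =
      barTwoSeries id k := by
  rw [sub_mul, one_mul, mul_assoc, sub_eq_iff_eq_add]
  ext i
  cases i with
  | zero => simp [barTwoSeries, chainSum]
  | succ i =>
    rw [map_add, PowerSeries.coeff_succ_X_mul, PowerSeries.coeff_C_mul]
    simp only [barTwoSeries, PowerSeries.coeff_mk, List.replicate_succ]
    rw [chainSum_cons_succ]
    rfl

theorem barTwoCoeff_zero_left (k : ℕ) : barTwoCoeff 0 k = 1 := by
  simp [barTwoCoeff, PowerSeries.coeff_mul, barTwoSeries, chainSum]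

theorem barTwoCoeff_succ_zero (m : ℕ) : barTwoCoeff (m + 1) 0 = 0 := by
  have h : ∀ b, barTwoSeries b 0 = 1 := fun b => by
    ext i
    cases i <;> simp [barTwoSeries, chainSum, List.replicate_succ, PowerSeries.coeff_one]
  simp [barTwoCoeff, h, PowerSeries.coeff_one]

theorem barTwoCoeff_succ_sub (m k : ℕ) :
    barTwoCoeff (m + 1) (k + 1) - barTwoCoeff (m + 1) k =
      weight (bar 2) (k + 1) * (barTwoCoeff m (k + 1) + barTwoCoeff m k) := by
  set P : ℕ → PowerSeries ℝ := fun k => barTwoSeries (fun n => n - 1) k * barTwoSeries id k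
    with hP
  have h : P (k + 1) - P k =
      PowerSeries.X * (PowerSeries.C (weight (bar 2) (k + 1)) * (P (k + 1) + P k)) := by
    simp only [hP]
    rw [← barTwoSeries_id_succ k, barTwoSeries_strict_succ k]
    ring
  have := congrArg (PowerSeries.coeff (m + 1)) h
  rwa [map_sub, PowerSeries.coeff_succ_X_mul, PowerSeries.coeff_C_mul, map_add] at this

theorem tendsto_barTwoCoeff (m : ℕ) :
    Filter.Tendsto (barTwoCoeff m) Filter.atTop
      (nhds (∑ k ∈ Finset.range (m + 1), zeta (List.replicate k (bar 2)) *
        zetaStar (List.replicate (m - k) (bar 2)))) := by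
  have h : ∀ n, barTwoCoeff m n = ∑ k ∈ Finset.range (m + 1),
      chainSum weight (fun n => n - 1) (List.replicate k (bar 2)) n *
        chainSum weight id (List.replicate (m - k) (bar 2)) n := by
    intro n
    rw [barTwoCoeff, PowerSeries.coeff_mul,
      Finset.Nat.sum_antidiagonal_eq_sum_range_succ_mk]
    simp [barTwoSeries]
  refine Filter.Tendsto.congr (fun n => (h n).symm) (tendsto_finsetSum _ fun k _ => ?_)
  exact (zetaSummable_bar_two k).tendsto_chainSum.mul
    (zetaStarSummable_bar_two (m - k)).tendsto_chainSum

/-- The coefficients one degree lower converge, hence are bounded, so the increments are `O(1 /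
k²)`. -/
theorem summable_barTwoCoeff_sub (m : ℕ) :
    Summable fun k => |barTwoCoeff m (k + 1) - barTwoCoeff m k| := by
  cases m with
  | zero => simp [barTwoCoeff_zero_left]
  | succ m =>
    obtain ⟨C, hC⟩ := (tendsto_barTwoCoeff m).abs.bddAbove_range
    have hC' : ∀ k, |barTwoCoeff m k| ≤ C := fun k => hC (Set.mem_range_self k)
    refine Summable.of_nonneg_of_le (fun _ => abs_nonneg _) (fun k => ?_)
      (summable_one_div_sq.mul_right (C + C))
    rw [barTwoCoeff_succ_sub, abs_mul, abs_weight]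
    exact mul_le_mul_of_nonneg_left
      ((abs_add_le _ _).trans (add_le_add (hC' _) (hC' _))) (by positivity)

theorem zetaStar_threeOne (m : ℕ) :
    (-1) ^ m * zetaStar (threeOne m) =
      ∑ k ∈ Finset.range (m + 1), zeta (List.replicate k (bar 2)) *
        zetaStar (List.replicate (m - k) (bar 2)) := by
  have h1 := (zetaStarSummable_threeOne m).tendsto_chainSum.const_mul ((-1) ^ m)
  refine tendsto_nhds_unique (h1.congr fun n => ?_)
    (tendsto_kernelSum (summable_barTwoCoeff_sub m) (tendsto_barTwoCoeff m))
  refine chainSum_threeOne barTwoCoeff_zero_left barTwoCoeff_succ_zero (fun m k => ?_) m n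
  have : (k : ℝ) + 1 ≠ 0 := by positivity
  rw [barTwoCoeff_succ_sub, weight_bar_two]
  field_simp

end EulerSum

theorem mainTheorem9 :
    -- all the series involved converge absolutely
    (∀ k : ℕ, EulerSum.ZetaSummable (EulerSum.rep [EulerSum.bar 2] k) ∧
      EulerSum.ZetaStarSummable (EulerSum.rep [EulerSum.bar 2] k)) ∧
    ∀ d : ℕ,
      (EulerSum.ZetaStarSummable (EulerSum.rep [EulerSum.plain 3, EulerSum.plain 1] d) ∧
        EulerSum.zetaStar (EulerSum.rep [EulerSum.plain 3, EulerSum.plain 1] d) =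
          ∑ k ∈ Finset.range (2 * d + 1),
            EulerSum.zeta (EulerSum.rep [EulerSum.bar 2] k) *
              EulerSum.zetaStar (EulerSum.rep [EulerSum.bar 2] (2 * d - k))) ∧
      (EulerSum.ZetaStarSummable
          (EulerSum.rep [EulerSum.plain 3, EulerSum.plain 1] d ++ [EulerSum.plain 2]) ∧
        EulerSum.zetaStar
            (EulerSum.rep [EulerSum.plain 3, EulerSum.plain 1] d ++ [EulerSum.plain 2]) =
          -∑ k ∈ Finset.range (2 * d + 2),
            EulerSum.zeta (EulerSum.rep [EulerSum.bar 2] k) *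
              EulerSum.zetaStar (EulerSum.rep [EulerSum.bar 2] (2 * d + 1 - k))) := by
  simp only [EulerSum.rep_three_one, EulerSum.threeOne_append_two, EulerSum.rep_singleton]
  refine ⟨fun k => ⟨EulerSum.zetaSummable_bar_two k, EulerSum.zetaStarSummable_bar_two k⟩,
    fun d => ⟨⟨EulerSum.zetaStarSummable_threeOne _, ?_⟩,
      ⟨EulerSum.zetaStarSummable_threeOne _, ?_⟩⟩⟩
  · rw [← EulerSum.zetaStar_threeOne, pow_mul]
    norm_num
  · rw [← EulerSum.zetaStar_threeOne (2 * d + 1), pow_succ, pow_mul]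
    norm_num
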